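/- Let $\mathcal K,\mathcal G$ be real Hilbert spaces, let $B:\mathcal K\to 2^{\mathcal K}$ and $D:\mathcal G\to 2^{\mathcal G}$ be maximally monotone, let $E:\mathcal K\to\mathcal K$ be monotone and $\delta$-Lipschitz continuous with $\delta\ge 0$, and let $V:\mathcal K\to\mathcal G$ be linear and bounded. Let $F:\mathcal K\to\mathcal K$ be $\beta^{-1}$-cocoercive with $\beta>0$, i.e. $\langle Fx-Fx',x-x'\rangle\ge\beta^{-1}\|Fx-Fx'\|^2$ for all $x,x'\in\mathcal K$; if $F=0$, the choice $\beta=0$ is also allowed. Assume that the primal problem of finding $y\in\mathcal K$ with $$0\in By+V^*D(Vy)+Ey+Fy \tag{P}$$ has at least one solution, and consider also the primal-dual problem of finding $(y,z)\in\mathcal K\times\mathcal G$ with $$0\in By+V^*z+Ey+Fy,\qquad 0\in D^{-1}z-Vy. \tag{PD}$$ Let $\tau,\sigma>0$, let $y_{-1},y_0\in\mathcal K$ and $z_0,\nu_0\in\mathcal G$ be arbitrary, and for all $k\in\mathbb N=\{0,1,2,\dots\}$ let $$\begin{aligned} \nu_{k+1}&=(\mathrm{Id}+\sigma D^{-1})^{-1}(z_k+\sigma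 Vy_k),\\ y_{k+1}&=(\mathrm{Id}+\tau B)^{-1}\bigl(y_k-\tau V^*(z_k+\nu_{k+1}-\nu_k)-\tau(2Ey_k-Ey_{k-1})-\tau Fy_k\bigr),\\ z_{k+1}&=(\mathrm{Id}+\sigma D^{-1})^{-1}(z_k+\sigma Vy_{k+1}). \end{aligned}$$ If $$2\tau\sigma\|V\|^2+\tau\bigl(2\delta+\tfrac{\beta}{2}\bigr)<1,$$ then there are $y^\star\in\mathcal K$ and $z^\star\in\mathcal G$ such that $y_k\rightharpoonup y^\star$ and $z_k\rightharpoonup z^\star$ weakly, $y^\star$ solves (P), and $(y^\star,z^\star)$ solves (PD). -/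

import Mathlib

open Filter Topology
open scoped NNReal Pointwise

namespace PrimalDual

/-- A set-valued operator `A : X → 2^X` is monotone if `⟪u - v, x - y⟫ ≥ 0` for all `(x, u)` and
`(y, v)` in its graph. -/
def IsMonotone {X : Type*} [NormedAddCommGroup X] [InnerProductSpace ℝ X]
    (A : X → Set X) : Prop :=
  ∀ x y : X, ∀ u ∈ A x, ∀ v ∈ A y, 0 ≤ inner ℝ (u - v) (x - y)

/-- A set-valued operator is maximally monotone if it is monotone and its graph is not properly
contained in the graph of another monotone operator. -/
def IsMaximallyMonotone {X : Type*} [NormedAddCommGroup X] [InnerProductSpace ℝ X]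
    (A : X → Set X) : Prop :=
  IsMonotone A ∧ ∀ A' : X → Set X, IsMonotone A' → (∀ x, A x ⊆ A' x) → A' = A

/-- `F` is `c`-cocoercive: `⟪F x - F y, x - y⟫ ≥ c ‖F x - F y‖²`. -/
def IsCocoercive {X : Type*} [NormedAddCommGroup X] [InnerProductSpace ℝ X]
    (c : ℝ) (F : X → X) : Prop :=
  ∀ x y : X, c * ‖F x - F y‖ ^ 2 ≤ inner ℝ (F x - F y) (x - y)

/-- The inverse of a set-valued operator: `x ∈ A⁻¹ u` iff `u ∈ A x`. -/
def opInv {X Y : Type*} (A : X → Set Y) : Y → Set X :=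
  fun u => {x | u ∈ A x}

/-- The resolvent `(Id + τ A)⁻¹`, as a set-valued operator. (For `A` maximally monotone and `τ > 0`
each of its values is a singleton.) -/
def setResolvent {X : Type*} [NormedAddCommGroup X] [InnerProductSpace ℝ X]
    (τ : ℝ) (A : X → Set X) : X → Set X :=
  opInv (fun p => {p} + τ • A p)

section

variable {K G : Type*}
  [NormedAddCommGroup K] [InnerProductSpace ℝ K] [CompleteSpace K]
  [NormedAddCommGroup G] [InnerProductSpace ℝ G] [CompleteSpace G]

/-- `y` solves the primal inclusion `0 ∈ B y + V* (D (V y)) + E y + F y`. -/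
def IsPrimalSolution (B : K → Set K) (D : G → Set G) (E F : K → K) (V : K →L[ℝ] G)
    (y : K) : Prop :=
  (0 : K) ∈ B y + V.adjoint '' D (V y) + {E y} + {F y}

/-- `(y, z)` solves the primal-dual inclusion
`0 ∈ B y + V* z + E y + F y`, `0 ∈ D⁻¹ z - V y`. -/
def IsPrimalDualSolution (B : K → Set K) (D : G → Set G) (E F : K → K) (V : K →L[ℝ] G)
    (y : K) (z : G) : Prop :=
  (0 : K) ∈ B y + {V.adjoint z} + {E y} + {F y} ∧ (0 : G) ∈ opInv D z - {V y}

/-- The sequence `k ↦ y (k - 1)`, where the value at `k = 0` is the given `y₋₁`. -/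
def previous {X : Type*} (yneg : X) (y : ℕ → X) : ℕ → X
  | 0 => yneg
  | k + 1 => y k

/-- The sequences `y`, `z`, `ν` are generated by the primal-dual method with resolvent corrected
kernel and step sizes `τ`, `σ`, from the starting points `y₋₁ = yneg`, `y 0`, `z 0`, `ν 0`. -/
structure IsResolventCorrectedIteration (B : K → Set K) (D : G → Set G) (E F : K → K)
    (V : K →L[ℝ] G) (τ σ : ℝ) (yneg : K) (y : ℕ → K) (z ν : ℕ → G) : Prop where
  nu_step : ∀ k, ν (k + 1) ∈ setResolvent σ (opInv D) (z k + σ • V (y k))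
  y_step : ∀ k, y (k + 1) ∈ setResolvent τ B
    (y k - τ • V.adjoint (z k + ν (k + 1) - ν k)
      - τ • ((2 : ℝ) • E (y k) - E (previous yneg y k)) - τ • F (y k))
  z_step : ∀ k, z (k + 1) ∈ setResolvent σ (opInv D) (z k + σ • V (y (k + 1)))

end

/-- Weak convergence of a sequence, i.e. convergence in the weak topology. -/
def WeaklyConverges {X : Type*} [NormedAddCommGroup X] [InnerProductSpace ℝ X]
    (x : ℕ → X) (l : X) : Prop :=
  Tendsto (fun k => toWeakSpace ℝ X (x k)) atTop (𝓝 (toWeakSpace ℝ X l))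

end PrimalDual

namespace PrimalDual

/-! With q_k = V*(z_{k+1} - ν_{k+1}) + E y_{k+1} - E y_k, the method is a proximal step perturbed by
q_{k+1} - q_k, with F evaluated one step behind (`mem_B`, `mem_D`). Since z_{k+1} and ν_{k+1} come
from one nonexpansive resolvent, ‖q_k‖ ≤ L‖y_{k+1} - y_k‖ with L = σ‖V‖² + δ (`norm_correction_le`).
The step-size condition then makes a Lyapunov function decrease, for every solution
(`lyapunov_step`, `fejer`). Hence the iterates are bounded, successive differences vanish, and
weighted distances to solutions converge.

Every weak cluster point is a solution (`exists_innerTendsto_solution`): the duality pairings of B,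
D, E, F add up to a null quantity, so none can lose mass in the limit, and each graph can be closed
separately. Opial's argument (`exists_innerTendsto_of_opial`) concludes. Ultrafilters replace
subsequences, so all bounded scalar limits exist at once. -/

/-- `x` converges weakly to `a` along the filter `l`, expressed through inner products. -/
def InnerTendsto {ι X : Type*} [NormedAddCommGroup X] [InnerProductSpace ℝ X]
    (x : ι → X) (l : Filter ι) (a : X) : Prop :=
  ∀ v, Tendsto (fun k => inner ℝ (x k) v) l (𝓝 (inner ℝ a v))

/-! ### Weak limits along filters -/

section Weak

variable {ι X Y : Type*} [NormedAddCommGroup X] [InnerProductSpace ℝ X]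
  [NormedAddCommGroup Y] [InnerProductSpace ℝ Y]

theorem InnerTendsto.add {x x' : ι → X} {l : Filter ι} {a a' : X} (h : InnerTendsto x l a)
    (h' : InnerTendsto x' l a') : InnerTendsto (fun k => x k + x' k) l (a + a') := fun v => by
  simpa only [inner_add_left] using (h v).add (h' v)

theorem InnerTendsto.sub {x x' : ι → X} {l : Filter ι} {a a' : X} (h : InnerTendsto x l a)
    (h' : InnerTendsto x' l a') : InnerTendsto (fun k => x k - x' k) l (a - a') := fun v => by
  simpa only [inner_sub_left] using (h v).sub (h' v)

theorem InnerTendsto.of_tendsto {x : ι → X} {l : Filter ι} {a : X} (h : Tendsto x l (𝓝 a)) :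
    InnerTendsto x l a := fun _ => h.inner tendsto_const_nhds

theorem InnerTendsto.map [CompleteSpace X] [CompleteSpace Y] {x : ι → X} {l : Filter ι} {a : X}
    (h : InnerTendsto x l a) (T : X →L[ℝ] Y) : InnerTendsto (fun k => T (x k)) l (T a) := fun v => by
  simpa only [ContinuousLinearMap.adjoint_inner_right] using h (T.adjoint v)

theorem exists_tendsto_of_abs_le {f : ι → ℝ} {C : ℝ} (U : Ultrafilter ι) (h : ∀ k, |f k| ≤ C) :
    ∃ c, Tendsto f U (𝓝 c) := by
  obtain ⟨c, -, hc⟩ := (isCompact_Icc (a := -C) (b := C)).ultrafilter_le_nhds (U.map f)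
    (by
      rw [Filter.le_principal_iff]
      exact Filter.mem_map.2 (Filter.univ_mem' fun k => abs_le.1 (h k)))
  exact ⟨c, hc⟩

theorem exists_tendsto_inner {u x : ι → X} {C C' : ℝ} (U : Ultrafilter ι)
    (hu : ∀ k, ‖u k‖ ≤ C) (hx : ∀ k, ‖x k‖ ≤ C') :
    ∃ c, Tendsto (fun k => inner ℝ (u k) (x k)) U (𝓝 c) :=
  exists_tendsto_of_abs_le (C := C * C') U fun k =>
    (abs_real_inner_le_norm _ _).trans
      (mul_le_mul (hu k) (hx k) (norm_nonneg _) ((norm_nonneg _).trans (hu k)))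

/-- A bounded family in a Hilbert space converges weakly along every ultrafilter. -/
theorem exists_innerTendsto [CompleteSpace X] {x : ι → X} {C : ℝ} (U : Ultrafilter ι)
    (hx : ∀ k, ‖x k‖ ≤ C) : ∃ a, InnerTendsto x U a := by
  -- The scalar limits form a bounded linear functional; Riesz representation gives the weak limit.
  choose f hf using fun v : X => exists_tendsto_inner U hx (fun _ : ι => le_refl ‖v‖)
  let φ : X →ₗ[ℝ] ℝ :=
    { toFun := f
      map_add' := fun v w => tendsto_nhds_unique (hf (v + w)) <| by
        simpa only [inner_add_right] using (hf v).add (hf w)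
      map_smul' := fun r v => tendsto_nhds_unique (hf (r • v)) <| by
        simpa only [real_inner_smul_right, smul_eq_mul, RingHom.id_apply]
          using (hf v).const_mul r }
  let Φ : StrongDual ℝ X := φ.mkContinuous C fun v =>
    le_of_tendsto (hf v).norm (Eventually.of_forall fun k =>
      (norm_inner_le_norm _ _).trans (mul_le_mul_of_nonneg_right (hx k) (norm_nonneg v)))
  refine ⟨(InnerProductSpace.toDual ℝ X).symm Φ, fun v => ?_⟩
  rw [InnerProductSpace.toDual_symm_apply]
  exact hf v

theorem tendsto_inner_zero {e x : ι → X} {l : Filter ι} {C : ℝ} (he : Tendsto e l (𝓝 0))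
    (hx : ∀ k, ‖x k‖ ≤ C) : Tendsto (fun k => inner ℝ (e k) (x k)) l (𝓝 0) := by
  refine squeeze_zero_norm (a := fun k => ‖e k‖ * C) (fun k => ?_) ?_
  · exact (norm_inner_le_norm _ _).trans (mul_le_mul_of_nonneg_left (hx k) (norm_nonneg _))
  · simpa using he.norm.mul_const C

theorem weaklyConverges_of_innerTendsto [CompleteSpace X] {x : ℕ → X} {a : X}
    (h : InnerTendsto x atTop a) : WeaklyConverges x a := by
  refine (WeakBilin.tendsto_iff_forall_eval_tendsto (topDualPairing ℝ X).flip
    (fun u v huv => ?_)).2 fun φ => ?_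
  · refine ext_inner_right ℝ fun w => ?_
    have := DFunLike.congr_fun huv (InnerProductSpace.toDual ℝ X w)
    rw [real_inner_comm, real_inner_comm w]
    simpa using this
  have := h ((InnerProductSpace.toDual ℝ X).symm φ)
  simp only [real_inner_comm ((InnerProductSpace.toDual ℝ X).symm φ),
    InnerProductSpace.toDual_symm_apply] at this
  exact this

end Weak

/-! ### Monotone operators and resolvents -/

section Monotone

variable {ι X : Type*} [NormedAddCommGroup X] [InnerProductSpace ℝ X]

/-- A maximally monotone operator contains every point monotonically related to its graph. -/
theorem IsMaximallyMonotone.mem_of_forall {A : X → Set X} (hA : IsMaximallyMonotone A) {x u : X}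
    (h : ∀ y, ∀ v ∈ A y, 0 ≤ inner ℝ (u - v) (x - y)) : u ∈ A x := by
  have key : (fun y => A y ∪ {v | y = x ∧ v = u}) = A := by
    refine hA.2 _ ?_ fun y => Set.subset_union_left
    rintro y₁ y₂ v₁ (h₁ | ⟨rfl, rfl⟩) v₂ (h₂ | ⟨rfl, rfl⟩)
    · exact hA.1 _ _ _ h₁ _ h₂
    · rw [← neg_sub v₂ v₁, ← neg_sub y₂ y₁, inner_neg_neg]
      exact h _ _ h₁
    · exact h _ _ h₂
    · simp
  rw [← key]
  exact Or.inr ⟨rfl, rfl⟩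

theorem isMaximallyMonotone_of_continuous {T : X → X} (hT : IsMonotone fun x => {T x})
    (hc : Continuous T) : IsMaximallyMonotone fun x => {T x} := by
  refine ⟨hT, fun A hA hsub => funext fun x => (Set.Subset.antisymm (fun u hu => ?_) (hsub x))⟩
  -- Minty's trick: test monotonicity along the ray from `x` in direction `u - T x`, divide by `t`,
  -- and let `t` decrease to 0.
  have hdir : ∀ t : ℝ, 0 < t → inner ℝ (u - T (x + t • (u - T x))) (u - T x) ≤ 0 := fun t ht => by
    have := hA x (x + t • (u - T x)) u hu _ (hsub _ rfl)
    rw [sub_add_cancel_left, inner_neg_right, real_inner_smul_right] at this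
    nlinarith
  have hlim : Tendsto (fun t : ℝ => inner ℝ (u - T (x + t • (u - T x))) (u - T x)) (𝓝[>] 0)
      (𝓝 (inner ℝ (u - T x) (u - T x))) := by
    have : Continuous fun t : ℝ => inner ℝ (u - T (x + t • (u - T x))) (u - T x) := by fun_prop
    simpa using (this.tendsto 0).mono_left nhdsWithin_le_nhds
  have h0 := le_of_tendsto hlim (eventually_mem_nhdsWithin.mono hdir)
  rw [real_inner_self_eq_norm_sq] at h0
  exact sub_eq_zero.1 (norm_eq_zero.1 (pow_eq_zero_iff two_ne_zero |>.1 (h0.antisymm (sq_nonneg _))))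

/-- Letting first `j` and then `k` run along `l` in the monotonicity inequality leaves 2c - 2⟨b, a⟩
≥ 0. -/
theorem inner_le_of_pairwise_monotone {l : Filter ι} [l.NeBot] {x u : ι → X} {a b : X} {c : ℝ}
    (hmono : ∀ k j, 0 ≤ inner ℝ (u k - u j) (x k - x j))
    (hx : InnerTendsto x l a) (hu : InnerTendsto u l b)
    (hc : Tendsto (fun k => inner ℝ (u k) (x k)) l (𝓝 c)) : inner ℝ b a ≤ c := by
  have h1 : ∀ k, 0 ≤ inner ℝ (u k) (x k) - inner ℝ (u k) a - inner ℝ b (x k) + c := fun k => by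
    have hx' := hx (u k)
    simp only [real_inner_comm (u k)] at hx'
    refine ge_of_tendsto' (((tendsto_const_nhds.sub hx').sub (hu (x k))).add hc) fun j => ?_
    have := hmono k j
    simp only [inner_sub_left, inner_sub_right] at this
    linarith
  have hx' := hx b
  simp only [real_inner_comm b] at hx'
  have := ge_of_tendsto' (((hc.sub (hu a)).sub hx').add tendsto_const_nhds) h1
  linarith

/-- Weak-weak closedness of the graph of a maximally monotone operator along families for which
the duality product passes to the limit. -/
theorem IsMaximallyMonotone.mem_of_innerTendsto {A : X → Set X} (hA : IsMaximallyMonotone A)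
    {l : Filter ι} [l.NeBot] {x u : ι → X} {a b : X} (hmem : ∀ k, u k ∈ A (x k))
    (hx : InnerTendsto x l a) (hu : InnerTendsto u l b)
    (hc : Tendsto (fun k => inner ℝ (u k) (x k)) l (𝓝 (inner ℝ b a))) : b ∈ A a := by
  refine hA.mem_of_forall fun y v hv => ?_
  have hx' := hx v
  simp only [real_inner_comm v] at hx'
  refine ge_of_tendsto' (x := l)
    (f := fun k => inner ℝ (u k) (x k) - inner ℝ (u k) y - inner ℝ v (x k) + inner ℝ v y) ?_
    fun k => ?_
  · have := ((hc.sub (hu y)).sub hx').add (tendsto_const_nhds (x := inner ℝ v y))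
    convert this using 2
    simp only [inner_sub_left, inner_sub_right]; ring
  · have := hA.1 _ _ _ (hmem k) _ hv
    simp only [inner_sub_left, inner_sub_right] at this
    linarith

theorem mem_setResolvent_iff {A : X → Set X} {τ : ℝ} (hτ : 0 < τ) {p x : X} :
    p ∈ setResolvent τ A x ↔ τ⁻¹ • (x - p) ∈ A p := by
  simp only [setResolvent, opInv, Set.mem_ofPred_eq, Set.singleton_add, Set.mem_image,
    Set.mem_smul_set]
  constructor
  · rintro ⟨_, ⟨v, hv, rfl⟩, rfl⟩
    simpa [smul_smul, inv_mul_cancel₀ hτ.ne'] using hv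
  · intro h
    exact ⟨_, ⟨_, h, rfl⟩, by simp [smul_smul, mul_inv_cancel₀ hτ.ne']⟩

/-- Resolvents of monotone operators are nonexpansive. -/
theorem norm_sub_le_of_mem_setResolvent {A : X → Set X} (hA : IsMonotone A) {τ : ℝ} (hτ : 0 < τ)
    {p q x y : X} (hp : p ∈ setResolvent τ A x) (hq : q ∈ setResolvent τ A y) :
    ‖p - q‖ ≤ ‖x - y‖ := by
  rw [mem_setResolvent_iff hτ] at hp hq
  have h := hA _ _ _ hp _ hq
  rw [← smul_sub, real_inner_smul_left] at h
  have h1 := nonneg_of_mul_nonneg_right h (inv_pos.2 hτ)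
  rw [show x - p - (y - q) = (x - y) - (p - q) by abel, inner_sub_left,
    real_inner_self_eq_norm_sq] at h1
  have h2 := real_inner_le_norm (x - y) (p - q)
  by_contra! h3
  nlinarith [norm_nonneg (x - y)]

theorem IsMonotone.opInv {A : X → Set X} (hA : IsMonotone A) : IsMonotone (opInv A) :=
  fun x y u hu v hv => by
    rw [real_inner_comm]
    exact hA u v x hu y hv

end Monotone

/-! ### Lyapunov estimates -/

section Descent

variable {K G : Type*}
  [NormedAddCommGroup K] [InnerProductSpace ℝ K]
  [NormedAddCommGroup G] [InnerProductSpace ℝ G]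

/-- Young's inequality absorbs the lag of F: here `b` is the old distance vector to a solution and
`c` the increment of y. This is the source of the β/2 in the step-size condition. -/
theorem neg_inner_cocoercive_le {f b c : K} {β : ℝ} (hβ : 0 ≤ β)
    (h : ‖f‖ ^ 2 ≤ β * inner ℝ f b) : -2 * inner ℝ f (b + c) ≤ β / 2 * ‖c‖ ^ 2 := by
  have h1 := (abs_le.1 (abs_real_inner_le_norm f c)).1
  rw [inner_add_right]
  rcases hβ.eq_or_lt with rfl | hβ
  · have : f = 0 := norm_eq_zero.1 (by nlinarith [norm_nonneg f])
    simp [this]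
  · have h2 : 0 ≤ (‖f‖ - β / 2 * ‖c‖) ^ 2 := sq_nonneg _
    have h3 : β * (-2 * (inner ℝ f b + inner ℝ f c)) ≤ β * (β / 2 * ‖c‖ ^ 2) := by
      nlinarith
    exact le_of_mul_le_mul_left h3 hβ

/-- The Lyapunov inequality of one step, with `dy`, `ey`, `dz`, `ez` the distance vectors to a
solution before and after the step, and `q`, `q'` the correction terms. -/
theorem lyapunov_step [CompleteSpace K] [CompleteSpace G] (V : K →L[ℝ] G) {a s β L r : ℝ}
    (hβ : 0 ≤ β) {dy ey q q' e f : K} {dz ez : G}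
    (hL : 0 ≤ L) (hq : ‖q‖ ≤ L * r)
    (hz : 0 ≤ inner ℝ (s • (dz - ez) + V ey) ez)
    (hy : 0 ≤ inner ℝ (a • (dy - ey) + (q' - q) - e - V.adjoint ez - f) ey)
    (he : 0 ≤ inner ℝ e ey) (hf : ‖f‖ ^ 2 ≤ β * inner ℝ f dy) :
    a * ‖ey‖ ^ 2 + s * ‖ez‖ ^ 2 - 2 * inner ℝ q' ey + L * ‖ey - dy‖ ^ 2
        + (a - β / 2 - 2 * L) * ‖ey - dy‖ ^ 2 + s * ‖ez - dz‖ ^ 2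
      ≤ a * ‖dy‖ ^ 2 + s * ‖dz‖ ^ 2 - 2 * inner ℝ q dy + L * r ^ 2 := by
  have h1 := neg_inner_cocoercive_le (c := ey - dy) hβ hf
  rw [add_sub_cancel] at h1
  have h2 : -2 * inner ℝ q (ey - dy) ≤ L * r ^ 2 + L * ‖ey - dy‖ ^ 2 := by
    have := (abs_le.1 (abs_real_inner_le_norm q (ey - dy))).1
    have h4 : ‖q‖ * ‖ey - dy‖ ≤ L * r * ‖ey - dy‖ :=
      mul_le_mul_of_nonneg_right hq (norm_nonneg _)
    -- Young's inequality for the product `r * ‖ey - dy‖`, with equal weights.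
    have h5 : 0 ≤ L * (r - ‖ey - dy‖) ^ 2 := mul_nonneg hL (sq_nonneg _)
    nlinarith
  have hyd : ‖dy‖ ^ 2 = ‖ey‖ ^ 2 + ‖ey - dy‖ ^ 2 + 2 * inner ℝ (dy - ey) ey := by
    simp only [← real_inner_self_eq_norm_sq, inner_sub_left, inner_sub_right,
      real_inner_comm ey dy]
    ring
  have hzd : ‖dz‖ ^ 2 = ‖ez‖ ^ 2 + ‖ez - dz‖ ^ 2 + 2 * inner ℝ (dz - ez) ez := by
    simp only [← real_inner_self_eq_norm_sq, inner_sub_left, inner_sub_right,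
      real_inner_comm ez dz]
    ring
  rw [hyd, hzd]
  rw [inner_add_left, real_inner_smul_left] at hz
  rw [inner_sub_left, inner_sub_left, inner_sub_left, inner_add_left, inner_sub_left (q'),
    ContinuousLinearMap.adjoint_inner_left, real_inner_smul_left, real_inner_comm] at hy
  rw [real_inner_comm] at hy
  rw [inner_sub_right] at h2
  have hc : inner ℝ (V ey) ez = inner ℝ ez (V ey) := real_inner_comm _ _
  linarith

theorem lyapunov_lower_bound {a L r : ℝ} {dy q : K} (hL : 0 ≤ L) (hq : ‖q‖ ≤ L * r) (w : ℝ) :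
    (a - L) * ‖dy‖ ^ 2 + w ≤ a * ‖dy‖ ^ 2 + w - 2 * inner ℝ q dy + L * r ^ 2 := by
  have h1 := real_inner_le_norm q dy
  have h4 : ‖q‖ * ‖dy‖ ≤ L * r * ‖dy‖ := mul_le_mul_of_nonneg_right hq (norm_nonneg _)
  have h5 : 0 ≤ L * (r - ‖dy‖) ^ 2 := mul_nonneg hL (sq_nonneg _)
  nlinarith

/-- A nonnegative sequence decreasing by at least `g k` converges, and `g` tends to zero. -/
theorem tendsto_of_add_le {Φ g : ℕ → ℝ} (hΦ : ∀ k, 0 ≤ Φ k) (hg : ∀ k, 0 ≤ g k)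
    (h : ∀ k, Φ (k + 1) + g k ≤ Φ k) :
    (∃ c, Tendsto Φ atTop (𝓝 c)) ∧ Tendsto g atTop (𝓝 0) ∧ ∀ k, Φ k ≤ Φ 0 := by
  have hanti : Antitone Φ := antitone_nat_of_succ_le fun k => by linarith [h k, hg k]
  have hlim := tendsto_atTop_ciInf hanti ⟨0, by rintro _ ⟨k, rfl⟩; exact hΦ k⟩
  refine ⟨⟨_, hlim⟩, ?_, fun k => hanti (Nat.zero_le k)⟩
  refine squeeze_zero hg (fun k => le_sub_iff_add_le'.2 (h k)) ?_
  simpa using hlim.sub (hlim.comp (tendsto_add_atTop_nat 1))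

theorem tendsto_zero_of_mul_norm_sq {X : Type*} [NormedAddCommGroup X] {c : ℝ} (hc : 0 < c)
    {x : ℕ → X} {g : ℕ → ℝ} (hg : Tendsto g atTop (𝓝 0)) (h : ∀ k, c * ‖x k‖ ^ 2 ≤ g k) :
    Tendsto x atTop (𝓝 0) := by
  have h1 : Tendsto (fun k => ‖x k‖ ^ 2) atTop (𝓝 0) := by
    refine squeeze_zero (fun k => sq_nonneg _) (fun k => ?_) (by simpa using hg.const_mul c⁻¹)
    rw [← div_eq_inv_mul, le_div_iff₀ hc, mul_comm]
    exact h k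
  rw [tendsto_zero_iff_norm_tendsto_zero]
  simpa [Real.sqrt_sq (norm_nonneg _)] using h1.sqrt

theorem norm_le_of_mul_norm_sq {X : Type*} [NormedAddCommGroup X] {c M : ℝ} (hc : 0 < c)
    {x : X} (h : c * ‖x‖ ^ 2 ≤ M) : ‖x‖ ≤ √(M / c) :=
  Real.le_sqrt_of_sq_le (by rw [le_div_iff₀ hc, mul_comm]; exact h)

end Descent

/-! ### Cluster points and Opial's argument -/

section Cluster

variable {ι K G : Type*}
  [NormedAddCommGroup K] [InnerProductSpace ℝ K]
  [NormedAddCommGroup G] [InnerProductSpace ℝ G]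

/-- A weak limit along an ultrafilter of bounded approximate solutions of the primal-dual inclusion
exists, and it is a solution. -/
theorem exists_innerTendsto_solution [CompleteSpace K] [CompleteSpace G] {B : K → Set K}
    {D : G → Set G} {E F : K → K} (V : K →L[ℝ] G) (hB : IsMaximallyMonotone B) (hD : IsMaximallyMonotone D)
    (hE : IsMaximallyMonotone fun x => {E x}) (hF : IsMaximallyMonotone fun x => {F x})
    (U : Ultrafilter ι) {y p : ι → K} {z r : ι → G} {Cy Cz CE CF Cr : ℝ}
    (hy : ∀ k, ‖y k‖ ≤ Cy) (hz : ∀ k, ‖z k‖ ≤ Cz) (hEy : ∀ k, ‖E (y k)‖ ≤ CE)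
    (hFy : ∀ k, ‖F (y k)‖ ≤ CF) (hr : ∀ k, ‖r k‖ ≤ Cr)
    (hp_mem : ∀ k, p k ∈ B (y k)) (hr_mem : ∀ k, z k ∈ D (r k))
    (hp_lim : Tendsto (fun k => p k + V.adjoint (z k) + E (y k) + F (y k)) U (𝓝 0))
    (hr_lim : Tendsto (fun k => r k - V (y k)) U (𝓝 0)) :
    ∃ a b, InnerTendsto y U a ∧ InnerTendsto z U b ∧
      -(V.adjoint b + E a + F a) ∈ B a ∧ b ∈ D (V a) := by
  obtain ⟨a, ha⟩ := exists_innerTendsto U hy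
  obtain ⟨b, hb⟩ := exists_innerTendsto U hz
  obtain ⟨e, he⟩ := exists_innerTendsto U hEy
  obtain ⟨f, hf⟩ := exists_innerTendsto U hFy
  obtain ⟨cE, hcE⟩ := exists_tendsto_inner U hEy hy
  obtain ⟨cF, hcF⟩ := exists_tendsto_inner U hFy hy
  obtain ⟨cD, hcD⟩ := exists_tendsto_inner U hz hr
  have hr_weak : InnerTendsto r U (V a) := by
    simpa using (InnerTendsto.of_tendsto hr_lim).add (ha.map V)
  have hp_weak : InnerTendsto p U (0 - V.adjoint b - e - f) := by
    have := (((InnerTendsto.of_tendsto hp_lim).sub (hb.map V.adjoint)).sub he).sub hf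
    convert this using 2
    abel
  -- ⟨p, y⟩ equals ⟨p + V*z + Ey + Fy, y⟩ + ⟨r - Vy, z⟩ - ⟨z, r⟩ - ⟨Ey, y⟩ - ⟨Fy, y⟩, and the first
  -- two terms vanish in the limit.
  have hcB : Tendsto (fun k => inner ℝ (p k) (y k)) U (𝓝 (0 + 0 - cD - cE - cF)) := by
    have := ((((tendsto_inner_zero hp_lim hy).add (tendsto_inner_zero hr_lim hz)).sub hcD).sub
      hcE).sub hcF
    convert this using 2 with k
    simp only [inner_add_left, ContinuousLinearMap.adjoint_inner_left, real_inner_comm (z k),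
      inner_sub_right]
    ring
  have iE := inner_le_of_pairwise_monotone (fun k j => hE.1 _ _ _ rfl _ rfl) ha he hcE
  have iF := inner_le_of_pairwise_monotone (fun k j => hF.1 _ _ _ rfl _ rfl) ha hf hcF
  have iD := inner_le_of_pairwise_monotone
    (fun k j => hD.1 _ _ _ (hr_mem k) _ (hr_mem j)) hr_weak hb hcD
  have iB := inner_le_of_pairwise_monotone
    (fun k j => hB.1 _ _ _ (hp_mem k) _ (hp_mem j)) ha hp_weak hcB
  have hsum : inner ℝ (0 - V.adjoint b - e - f) a
      = - inner ℝ b (V a) - inner ℝ e a - inner ℝ f a := by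
    simp [inner_sub_left, ContinuousLinearMap.adjoint_inner_left]
  -- By `hsum`, the two sides of `iB`, `iD`, `iE`, `iF` both sum to zero, so all four are
  -- equalities; this is the pairing limit that closes each graph.
  have mE : e = E a := hE.mem_of_innerTendsto (x := y) (u := fun k => E (y k)) (fun k => rfl) ha he
    (by convert hcE using 2; linarith)
  have mF : f = F a := hF.mem_of_innerTendsto (x := y) (u := fun k => F (y k)) (fun k => rfl) ha hf
    (by convert hcF using 2; linarith)
  have mD := hD.mem_of_innerTendsto hr_mem hr_weak hb (by convert hcD using 2; linarith)
  have mB := hB.mem_of_innerTendsto hp_mem ha hp_weak (by convert hcB using 2; linarith)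
  refine ⟨a, b, ha, hb, ?_, mD⟩
  rw [← mE, ← mF]
  convert mB using 1
  abel

/-- Opial's lemma in a product of two Hilbert spaces with weighted norms. -/
theorem exists_innerTendsto_of_opial {s t : ℝ} (hs : 0 < s) (ht : 0 < t) {y : ℕ → K} {z : ℕ → G}
    {S : K → G → Prop}
    (hconv : ∀ a b, S a b →
      ∃ c, Tendsto (fun k => s * ‖y k - a‖ ^ 2 + t * ‖z k - b‖ ^ 2) atTop (𝓝 c))
    (hcluster : ∀ U : Ultrafilter ℕ, (U : Filter ℕ) ≤ atTop →
      ∃ a b, InnerTendsto y U a ∧ InnerTendsto z U b ∧ S a b) :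
    ∃ a b, InnerTendsto y atTop a ∧ InnerTendsto z atTop b ∧ S a b := by
  obtain ⟨U₀, hU₀⟩ : ∃ U : Ultrafilter ℕ, (U : Filter ℕ) ≤ atTop := ⟨_, Ultrafilter.of_le _⟩
  obtain ⟨a, b, ha, hb, hab⟩ := hcluster U₀ hU₀
  have huniq : ∀ U : Ultrafilter ℕ, (U : Filter ℕ) ≤ atTop →
      InnerTendsto y U a ∧ InnerTendsto z U b := fun U hU => by
    obtain ⟨a', b', ha', hb', hab'⟩ := hcluster U hU
    obtain ⟨c, hc⟩ := hconv a b hab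
    obtain ⟨c', hc'⟩ := hconv a' b' hab'
    -- The quadratic terms cancel in the difference of the two weighted distances, which is
    -- therefore affine in the iterate and passes to weak limits. Its limit c' - c is the same at
    -- both cluster points, which forces them to coincide.
    have hlim : ∀ (W : Ultrafilter ℕ) (α : K) (γ : G), (W : Filter ℕ) ≤ atTop →
        InnerTendsto y W α → InnerTendsto z W γ →
        c' - c = 2 * (s * inner ℝ α (a - a') + t * inner ℝ γ (b - b'))
          + s * (‖a'‖ ^ 2 - ‖a‖ ^ 2) + t * (‖b'‖ ^ 2 - ‖b‖ ^ 2) := fun W α γ hW hα hγ => by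
      refine tendsto_nhds_unique ((hc'.sub hc).mono_left hW) ?_
      have := (((((hα (a - a')).const_mul s).add ((hγ (b - b')).const_mul t)).const_mul 2).add
        (tendsto_const_nhds (x := s * (‖a'‖ ^ 2 - ‖a‖ ^ 2)))).add
        (tendsto_const_nhds (x := t * (‖b'‖ ^ 2 - ‖b‖ ^ 2)))
      convert this using 2 with k
      simp only [norm_sub_sq_real, inner_sub_right]
      ring
    have h1 := hlim U₀ a b hU₀ ha hb
    have h2 := hlim U a' b' hU ha' hb'
    have h3 : s * ‖a - a'‖ ^ 2 + t * ‖b - b'‖ ^ 2 = 0 := by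
      simp only [← real_inner_self_eq_norm_sq, inner_sub_left] at *
      linarith
    have hA : 0 ≤ s * ‖a - a'‖ ^ 2 := by positivity
    have hB : 0 ≤ t * ‖b - b'‖ ^ 2 := by positivity
    have ea : a = a' := by
      have : s * ‖a - a'‖ ^ 2 = 0 := by linarith
      simpa [hs.ne', sub_eq_zero] using this
    have eb : b = b' := by
      have : t * ‖b - b'‖ ^ 2 = 0 := by linarith
      simpa [ht.ne', sub_eq_zero] using this
    rw [ea, eb]
    exact ⟨ha', hb'⟩
  exact ⟨a, b, fun v => (tendsto_iff_ultrafilter _ _ _).2 fun U hU => (huniq U hU).1 v,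
    fun v => (tendsto_iff_ultrafilter _ _ _).2 fun U hU => (huniq U hU).2 v, hab⟩

end Cluster

/-! ### Consequences of cocoercivity -/

section Cocoercive

variable {K : Type*} [NormedAddCommGroup K] [InnerProductSpace ℝ K]

/-- Multiplying through by β gives one inequality that also covers F = 0, β = 0. -/
theorem cocoercive_bound {F : K → K} {β : ℝ}
    (hF : (0 < β ∧ IsCocoercive β⁻¹ F) ∨ (F = 0 ∧ β = 0)) :
    0 ≤ β ∧ ∀ x x', ‖F x - F x'‖ ^ 2 ≤ β * inner ℝ (F x - F x') (x - x') := by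
  rcases hF with ⟨hβ, hF⟩ | ⟨rfl, rfl⟩
  · exact ⟨hβ.le, fun x x' => (inv_mul_le_iff₀ hβ).1 (hF x x')⟩
  · simp

theorem lipschitzWith_of_cocoercive_bound {F : K → K} {β : ℝ} (hβ : 0 ≤ β)
    (hF : ∀ x x', ‖F x - F x'‖ ^ 2 ≤ β * inner ℝ (F x - F x') (x - x')) :
    LipschitzWith β.toNNReal F := by
  refine LipschitzWith.of_dist_le_mul fun x x' => ?_
  rw [dist_eq_norm, dist_eq_norm, Real.coe_toNNReal _ hβ]
  by_contra! hlt
  have h1 := mul_le_mul_of_nonneg_left (real_inner_le_norm (F x - F x') (x - x')) hβ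
  have h2 : 0 ≤ β * ‖x - x'‖ := by positivity
  nlinarith [hF x x']

theorem isMonotone_of_cocoercive_bound {F : K → K} {β : ℝ} (hβ : 0 ≤ β)
    (hF : ∀ x x', ‖F x - F x'‖ ^ 2 ≤ β * inner ℝ (F x - F x') (x - x')) :
    IsMonotone fun x => {F x} := by
  rintro x x' _ rfl _ rfl
  have h := hF x x'
  rcases hβ.eq_or_lt with rfl | hβ
  · rw [zero_mul] at h
    have : F x - F x' = 0 := by simpa using h.antisymm (sq_nonneg _)
    simp [this]
  · exact nonneg_of_mul_nonneg_right ((sq_nonneg _).trans h) hβ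

end Cocoercive

theorem exists_norm_le_of_lipschitzWith {ι K : Type*} [NormedAddCommGroup K] {T : K → K}
    {c : ℝ≥0} (hT : LipschitzWith c T) {x : ι → K} {C : ℝ} (hx : ∀ k, ‖x k‖ ≤ C) : ∃ C', ∀ k, ‖T (x k)‖ ≤ C' :=
  ⟨c * C + ‖T 0‖, fun k => by
    have h1 := hT.norm_sub_le (x k) 0
    rw [sub_zero] at h1
    have h2 := norm_le_norm_sub_add (T (x k)) (T 0)
    have h3 : c * ‖x k‖ ≤ c * C := mul_le_mul_of_nonneg_left (hx k) c.2
    linarith⟩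

/-! ### The iteration and its Fejér property -/

section Iteration

variable {K G : Type*}
  [NormedAddCommGroup K] [InnerProductSpace ℝ K] [CompleteSpace K]
  [NormedAddCommGroup G] [InnerProductSpace ℝ G] [CompleteSpace G]
  {B : K → Set K} {D : G → Set G} {E F : K → K} {V : K →L[ℝ] G}

theorem isPrimalDualSolution_of_mem {y : K} {z : G} (hB : -(V.adjoint z + E y + F y) ∈ B y)
    (hD : z ∈ D (V y)) : IsPrimalDualSolution B D E F V y z := by
  refine ⟨?_, ?_⟩
  · rw [Set.add_singleton, Set.add_singleton, Set.add_singleton]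
    exact ⟨_, ⟨_, ⟨_, hB, rfl⟩, rfl⟩, by dsimp only; abel⟩
  · rw [Set.sub_singleton]
    exact ⟨V y, hD, sub_self _⟩

theorem isPrimalSolution_iff {y : K} : IsPrimalSolution B D E F V y ↔
    ∃ z, -(V.adjoint z + E y + F y) ∈ B y ∧ z ∈ D (V y) := by
  rw [IsPrimalSolution, Set.add_singleton, Set.add_singleton]
  constructor
  · rintro ⟨_, ⟨_, ⟨b, hb, _, ⟨z, hz, rfl⟩, rfl⟩, rfl⟩, h⟩
    refine ⟨z, ?_, hz⟩
    convert hb using 1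
    dsimp only at h
    rw [neg_eq_iff_add_eq_zero, ← h]
    abel
  · rintro ⟨z, hb, hz⟩
    exact ⟨_, ⟨_, ⟨_, hb, _, ⟨z, hz, rfl⟩, rfl⟩, rfl⟩, by dsimp only; abel⟩

/-- The correction term `V* (z k - ν k) + E (y k) - E (y (k - 1))`, at the index `k + 1`. -/
noncomputable def correction (E : K → K) (V : K →L[ℝ] G) (y : ℕ → K) (z ν : ℕ → G) (k : ℕ) : K :=
  V.adjoint (z (k + 1) - ν (k + 1)) + (E (y (k + 1)) - E (y k))

namespace IsResolventCorrectedIteration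

variable {τ σ : ℝ} {yneg : K} {y : ℕ → K} {z ν : ℕ → G}

/-- The two resolvent arguments differ only by σV(y_{k+1} - y_k). The initial ν_0 and y_{-1} are
arbitrary and obey no such bound, hence the index starts at k + 1. -/
theorem norm_correction_le (h : IsResolventCorrectedIteration B D E F V τ σ yneg y z ν)
    (hD : IsMonotone D) {δ : ℝ≥0} (hE : LipschitzWith δ E) (hσ : 0 < σ) (k : ℕ) :
    ‖correction E V y z ν k‖ ≤ (σ * ‖V‖ ^ 2 + δ) * ‖y (k + 1) - y k‖ := by
  have h1 := norm_sub_le_of_mem_setResolvent hD.opInv hσ (h.z_step k) (h.nu_step k)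
  rw [add_sub_add_left_eq_sub, ← smul_sub, ← map_sub, norm_smul, Real.norm_of_nonneg hσ.le] at h1
  have h2 := V.le_opNorm (y (k + 1) - y k)
  have h3 : ‖V.adjoint (z (k + 1) - ν (k + 1))‖ ≤ ‖V‖ * ‖z (k + 1) - ν (k + 1)‖ := by
    simpa using V.adjoint.le_opNorm (z (k + 1) - ν (k + 1))
  calc ‖correction E V y z ν k‖
      ≤ ‖V.adjoint (z (k + 1) - ν (k + 1))‖ + ‖E (y (k + 1)) - E (y k)‖ := norm_add_le _ _
    _ ≤ ‖V‖ * (σ * (‖V‖ * ‖y (k + 1) - y k‖)) + δ * ‖y (k + 1) - y k‖ := by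
        gcongr
        · exact h3.trans (by gcongr; exact h1.trans (by gcongr))
        · exact hE.norm_sub_le _ _
    _ = _ := by ring

theorem mem_B (h : IsResolventCorrectedIteration B D E F V τ σ yneg y z ν) (hτ : 0 < τ) (k : ℕ) :
    τ⁻¹ • (y (k + 1) - y (k + 2))
      + (correction E V y z ν (k + 1) - correction E V y z ν k) - E (y (k + 2))
      - V.adjoint (z (k + 2)) - F (y (k + 1)) ∈ B (y (k + 2)) := by
  have h1 := (mem_setResolvent_iff hτ).1 (h.y_step (k + 1))
  convert h1 using 1
  simp only [correction, previous, smul_sub, smul_add, smul_smul, inv_mul_cancel₀ hτ.ne', one_smul,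
    map_sub, map_add, two_smul]
  abel

theorem mem_D (h : IsResolventCorrectedIteration B D E F V τ σ yneg y z ν) (hσ : 0 < σ) (k : ℕ) :
    z (k + 1) ∈ D (σ⁻¹ • (z k - z (k + 1)) + V (y (k + 1))) := by
  have h1 := (mem_setResolvent_iff hσ).1 (h.z_step k)
  have h2 : σ⁻¹ • (z k + σ • V (y (k + 1)) - z (k + 1))
      = σ⁻¹ • (z k - z (k + 1)) + V (y (k + 1)) := by
    simp only [smul_sub, smul_add, smul_smul, inv_mul_cancel₀ hσ.ne', one_smul]
    abel
  rwa [h2] at h1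

/-- The iterates are bounded and asymptotically regular, and their weighted distance to every
solution converges. -/
theorem fejer (h : IsResolventCorrectedIteration B D E F V τ σ yneg y z ν)
    (hB : IsMonotone B) (hD : IsMonotone D) (hE_mono : IsMonotone fun x => {E x})
    {δ : ℝ≥0} (hE : LipschitzWith δ E) {β : ℝ} (hβ : 0 ≤ β)
    (hF : ∀ x x', ‖F x - F x'‖ ^ 2 ≤ β * inner ℝ (F x - F x') (x - x'))
    (hτ : 0 < τ) (hσ : 0 < σ)
    (hstep : 2 * τ * σ * ‖V‖ ^ 2 + τ * (2 * (δ : ℝ) + β / 2) < 1)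
    {a : K} {b : G} (ha : -(V.adjoint b + E a + F a) ∈ B a) (hb : b ∈ D (V a)) :
    (∃ C, ∀ k, ‖y (k + 1)‖ ≤ C) ∧ (∃ C, ∀ k, ‖z (k + 1)‖ ≤ C) ∧
      Tendsto (fun k => y (k + 2) - y (k + 1)) atTop (𝓝 0) ∧
      Tendsto (fun k => z (k + 2) - z (k + 1)) atTop (𝓝 0) ∧
      Tendsto (correction E V y z ν) atTop (𝓝 0) ∧
      ∃ c, Tendsto (fun k => τ⁻¹ * ‖y (k + 1) - a‖ ^ 2 + σ⁻¹ * ‖z (k + 1) - b‖ ^ 2)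
        atTop (𝓝 c) := by
  set q := correction E V y z ν with hq
  set L : ℝ := σ * ‖V‖ ^ 2 + δ with hL
  have hL0 : 0 ≤ L := by positivity
  -- This is the step-size condition divided by τ.
  have hLτ : 0 < τ⁻¹ - β / 2 - 2 * L := by
    have h1 : τ * (2 * L + β / 2) < τ * τ⁻¹ := by
      rw [mul_inv_cancel₀ hτ.ne', hL]
      linarith
    linarith [lt_of_mul_lt_mul_left h1 hτ.le]
  have hσ' : 0 < σ⁻¹ := inv_pos.2 hσ
  have hqle : ∀ k, ‖q k‖ ≤ L * ‖y (k + 1) - y k‖ := h.norm_correction_le hD hE hσ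
  let Φ : ℕ → ℝ := fun k => τ⁻¹ * ‖y (k + 1) - a‖ ^ 2 + σ⁻¹ * ‖z (k + 1) - b‖ ^ 2
    - 2 * inner ℝ (q k) (y (k + 1) - a) + L * ‖y (k + 1) - y k‖ ^ 2
  let g : ℕ → ℝ := fun k => (τ⁻¹ - β / 2 - 2 * L) * ‖y (k + 2) - y (k + 1)‖ ^ 2
    + σ⁻¹ * ‖z (k + 2) - z (k + 1)‖ ^ 2
  have hlow : ∀ k, (τ⁻¹ - L) * ‖y (k + 1) - a‖ ^ 2 + σ⁻¹ * ‖z (k + 1) - b‖ ^ 2 ≤ Φ k :=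
    fun k => lyapunov_lower_bound hL0 (hqle k) _
  have hc : 0 < τ⁻¹ - L := by linarith
  have hy0 : ∀ k, 0 ≤ (τ⁻¹ - L) * ‖y (k + 1) - a‖ ^ 2 := fun k => by positivity
  have hz0 : ∀ k, 0 ≤ σ⁻¹ * ‖z (k + 1) - b‖ ^ 2 := fun k => by positivity
  have hgy : ∀ k, 0 ≤ (τ⁻¹ - β / 2 - 2 * L) * ‖y (k + 2) - y (k + 1)‖ ^ 2 :=
    fun k => by positivity
  have hgz : ∀ k, 0 ≤ σ⁻¹ * ‖z (k + 2) - z (k + 1)‖ ^ 2 := fun k => by positivity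
  have hdesc : ∀ k, Φ (k + 1) + g k ≤ Φ k := fun k => by
    have hz1 := hD _ _ _ (h.mem_D hσ (k + 1)) _ hb
    have hy1 := hB _ _ _ (h.mem_B hτ k) _ ha
    have he1 := hE_mono (y (k + 2)) a _ rfl _ rfl
    have := lyapunov_step V (a := τ⁻¹) (s := σ⁻¹) (q' := q (k + 1)) (dy := y (k + 1) - a)
      (ey := y (k + 2) - a) (dz := z (k + 1) - b) (ez := z (k + 2) - b) hβ hL0 (hqle k)
      (by
        rw [real_inner_comm, map_sub]
        convert hz1 using 2
        rw [sub_sub_sub_cancel_right]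
        abel)
      (by
        convert hy1 using 2
        rw [map_sub, sub_sub_sub_cancel_right]
        abel) he1 (hF (y (k + 1)) a)
    simp only [sub_sub_sub_cancel_right] at this
    exact (add_assoc _ _ _).symm.le.trans this
  obtain ⟨⟨c, hΦ⟩, hg, hbd⟩ := tendsto_of_add_le (fun k => (by linarith [hlow k, hy0 k, hz0 k]))
    (fun k => add_nonneg (hgy k) (hgz k)) hdesc
  have hΔy : Tendsto (fun k => y (k + 2) - y (k + 1)) atTop (𝓝 0) :=
    tendsto_zero_of_mul_norm_sq hLτ hg fun k => le_add_of_nonneg_right (hgz k)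
  have hΔz : Tendsto (fun k => z (k + 2) - z (k + 1)) atTop (𝓝 0) :=
    tendsto_zero_of_mul_norm_sq hσ' hg fun k => le_add_of_nonneg_left (hgy k)
  have hya : ∀ k, ‖y (k + 1) - a‖ ≤ √(Φ 0 / (τ⁻¹ - L)) := fun k =>
    norm_le_of_mul_norm_sq hc (by linarith [hlow k, hz0 k, hbd k])
  have hzb : ∀ k, ‖z (k + 1) - b‖ ≤ √(Φ 0 / σ⁻¹) := fun k =>
    norm_le_of_mul_norm_sq hσ' (by linarith [hlow k, hy0 k, hbd k])
  have hΔy' : Tendsto (fun k => y (k + 1) - y k) atTop (𝓝 0) := (tendsto_add_atTop_iff_nat 1).1 hΔy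
  have hq0 : Tendsto q atTop (𝓝 0) :=
    squeeze_zero_norm hqle (by simpa using hΔy'.norm.const_mul L)
  refine ⟨⟨_, fun k => (norm_le_norm_sub_add _ a).trans (add_le_add_left (hya k) _)⟩,
    ⟨_, fun k => (norm_le_norm_sub_add _ b).trans (add_le_add_left (hzb k) _)⟩, hΔy, hΔz, hq0,
    c, ?_⟩
  -- The terms by which `Φ` differs from the weighted distance tend to zero.
  have h2 := (hΦ.add ((tendsto_inner_zero hq0 hya).const_mul 2)).sub
    ((hΔy'.norm.pow 2).const_mul L)
  simp only [norm_zero, ne_eq, OfNat.ofNat_ne_zero, not_false_eq_true, zero_pow, mul_zero, add_zero,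
    sub_zero] at h2
  convert h2 using 2 with k
  simp only [Φ]
  ring

end IsResolventCorrectedIteration

end Iteration

end PrimalDual

/-! ### Weak convergence -/

theorem corollary6p5 {K G : Type*}
    [NormedAddCommGroup K] [InnerProductSpace ℝ K] [CompleteSpace K]
    [NormedAddCommGroup G] [InnerProductSpace ℝ G] [CompleteSpace G]
    (B : K → Set K) (D : G → Set G) (E F : K → K) (V : K →L[ℝ] G)
    (δ : ℝ≥0) (β τ σ : ℝ)
    (hB : PrimalDual.IsMaximallyMonotone B)
    (hD : PrimalDual.IsMaximallyMonotone D)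
    (hE_mono : PrimalDual.IsMonotone (fun x => {E x}))
    (hE_lip : LipschitzWith δ E)
    (hF : (0 < β ∧ PrimalDual.IsCocoercive β⁻¹ F) ∨ (F = 0 ∧ β = 0))
    (hsol : ∃ y : K, PrimalDual.IsPrimalSolution B D E F V y)
    (hτ : 0 < τ) (hσ : 0 < σ)
    (hstep : 2 * τ * σ * ‖V‖ ^ 2 + τ * (2 * (δ : ℝ) + β / 2) < 1)
    (yneg : K) (y : ℕ → K) (z ν : ℕ → G)
    (halg : PrimalDual.IsResolventCorrectedIteration B D E F V τ σ yneg y z ν) :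
    ∃ (ystar : K) (zstar : G),
      PrimalDual.WeaklyConverges y ystar ∧ PrimalDual.WeaklyConverges z zstar ∧
      PrimalDual.IsPrimalSolution B D E F V ystar ∧
      PrimalDual.IsPrimalDualSolution B D E F V ystar zstar := by
  open PrimalDual in
  obtain ⟨hβ, hF⟩ := cocoercive_bound hF
  have hF_lip := lipschitzWith_of_cocoercive_bound hβ hF
  have hE_max := isMaximallyMonotone_of_continuous hE_mono hE_lip.continuous
  have hF_max := isMaximallyMonotone_of_continuous (isMonotone_of_cocoercive_bound hβ hF)
    hF_lip.continuous
  have hfejer := fun (a : K) (b : G) => halg.fejer (a := a) (b := b) hB.1 hD.1 hE_mono hE_lip hβ hF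
    hτ hσ hstep
  obtain ⟨y₀, hy₀⟩ := hsol
  obtain ⟨z₀, hy₀, hz₀⟩ := isPrimalSolution_iff.1 hy₀
  obtain ⟨⟨Cy, hCy⟩, ⟨Cz, hCz⟩, hΔy, hΔz, hq, -⟩ := hfejer y₀ z₀ hy₀ hz₀
  obtain ⟨CE, hCE⟩ := exists_norm_le_of_lipschitzWith hE_lip hCy
  obtain ⟨CF, hCF⟩ := exists_norm_le_of_lipschitzWith hF_lip hCy
  -- `mem_B` has F at y_{k+1} but B at y_{k+2}; this difference repairs the mismatch in the residual
  -- `hp`.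
  have hΔF : Tendsto (fun k => F (y (k + 2)) - F (y (k + 1))) atTop (𝓝 0) :=
    squeeze_zero_norm (fun k => hF_lip.norm_sub_le _ _) (by simpa using hΔy.norm.const_mul _)
  have hr : Tendsto (fun k => σ⁻¹ • (z (k + 1) - z (k + 2))) atTop (𝓝 0) := by
    simpa [← smul_neg] using hΔz.const_smul (-σ⁻¹)
  have hp : Tendsto (fun k => τ⁻¹ • (y (k + 1) - y (k + 2))
      + (correction E V y z ν (k + 1) - correction E V y z ν k)
      + (F (y (k + 2)) - F (y (k + 1)))) atTop (𝓝 0) := by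
    have h1 : Tendsto (fun k => τ⁻¹ • (y (k + 1) - y (k + 2))) atTop (𝓝 0) := by
      simpa [← smul_neg] using hΔy.const_smul (-τ⁻¹)
    simpa using (h1.add (((tendsto_add_atTop_iff_nat 1).2 hq).sub hq)).add hΔF
  obtain ⟨Cr, hCr⟩ : ∃ C, ∀ k, ‖σ⁻¹ • (z (k + 1) - z (k + 2)) + V (y (k + 2))‖ ≤ C :=
    ⟨σ⁻¹ * (Cz + Cz) + ‖V‖ * Cy, fun k => (norm_add_le _ _).trans (add_le_add
      (by
        rw [norm_smul, Real.norm_of_nonneg (inv_pos.2 hσ).le]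
        exact mul_le_mul_of_nonneg_left ((norm_sub_le _ _).trans (add_le_add (hCz _) (hCz _)))
          (inv_pos.2 hσ).le)
      ((V.le_opNorm _).trans (mul_le_mul_of_nonneg_left (hCy _) (norm_nonneg _))))⟩
  obtain ⟨a, b, ha, hb, hBa, hDb⟩ := exists_innerTendsto_of_opial (inv_pos.2 hτ) (inv_pos.2 hσ)
    (y := fun k => y (k + 2)) (z := fun k => z (k + 2))
    (S := fun a b => -(V.adjoint b + E a + F a) ∈ B a ∧ b ∈ D (V a))
    (fun a b hab => by
      obtain ⟨-, -, -, -, -, c, hc⟩ := hfejer a b hab.1 hab.2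
      exact ⟨c, (tendsto_add_atTop_iff_nat 1).2 hc⟩)
    (fun U hU => exists_innerTendsto_solution V hB hD hE_max hF_max U
      (fun k => hCy (k + 1)) (fun k => hCz (k + 1)) (fun k => hCE (k + 1)) (fun k => hCF (k + 1))
      hCr (halg.mem_B hτ) (fun k => halg.mem_D hσ (k + 1))
      (by
        convert hp.mono_left hU using 2 with k
        abel)
      (by simpa using hr.mono_left hU))
  exact ⟨a, b,
    weaklyConverges_of_innerTendsto fun v => (tendsto_add_atTop_iff_nat 2).1 (ha v),
    weaklyConverges_of_innerTendsto fun v => (tendsto_add_atTop_iff_nat 2).1 (hb v),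
    isPrimalSolution_iff.2 ⟨b, hBa, hDb⟩, isPrimalDualSolution_of_mem hBa hDb⟩
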